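/- Let $E$ and $E'$ denote real Banach spaces of dimension at least $2$, and let $D\subsetneq E$, $D'\subsetneq E'$ denote domains (nonempty open connected sets). Write $d_D(z)$ for the distance from $z\in D$ to $\partial D$, and $$k_D(x,y)=\inf_\gamma\int_\gamma\frac{|dz|}{d_D(z)}\qquad(x,y\in D)$$ for the quasihyperbolic metric, the infimum being taken over all rectifiable curves $\gamma$ joining $x$ and $y$ in $D$. For a homeomorphism $\varphi:[0,\infty)\to[0,\infty)$, a homeomorphism $f:D\to D'$ is called $\varphi$-FQC (free $\varphi$-quasiconformal) if for every subdomain $G\subseteq D$ and all $x,y\in G$ $$k_{f(G)}(f(x),f(y))\le\varphi(k_G(x,y))\quad\text{and}\quad k_G(x,y)\le\varphi(k_{f(G)}(f(x),f(y))).$$ For a homeomorphism $\eta:[0,\infty)\to[0,\infty)$, metric spaces $X,Y$ and $A\subseteq X$, an embedding $g:X\to Y$ is called $\eta$-quasisymmetric relative to $A$ if $$\frac{|g(y)-g(x)|}{|g(z)-g(x)|}\le\eta\Big(\frac{|y-x|}{|z-x|}\Big)$$ for all triples of distinct points $x,y,z\in X$ with $x\in A$ or $\{y,z\}\subseteq A$.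 For $x\in D$ let $B_x$, $\overline B_x$ and $S_x$ be the open ball, the closed ball and the sphere with center $x$ and radius $d_D(x)$. **Theorem.** Let $\varphi,\eta:[0,\infty)\to[0,\infty)$ be homeomorphisms. There is a homeomorphism $\psi:[0,\infty)\to[0,\infty)$ with $\psi(t)\ge t$ for all $t$, depending only on $\varphi$ and $\eta$, such that the following holds for all $E,E',D,D'$ as above and every homeomorphism $f:D\to D'$. If for each $x\in D$ 1. $f|_{B_x}:B_x\to f(B_x)$ is $\varphi$-FQC, and 2. $f|_{\overline B_x}$ is $\eta$-quasisymmetric relative to $S_x$, meaning that $f|_{B_x}$ extends to an embedding $\overline B_x\to E'$ that is $\eta$-quasisymmetric relative to $S_x$, then $f$ is $\psi$-FQC. -/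

import Mathlib

open Set MeasureTheory
open scoped NNReal ENNReal

universe u v

namespace FreeQC

/-- A proper domain: a nonempty open connected set that is not the whole space. -/
def IsProperDomain {E : Type u} [TopologicalSpace E] (D : Set E) : Prop :=
  IsOpen D ∧ IsConnected D ∧ D ≠ univ

/-- `d_D(z)`, the distance from `z` to the boundary of `D`. -/
noncomputable def bdryDist {E : Type u} [MetricSpace E] (D : Set E) (z : E) : ℝ :=
  Metric.infDist z (frontier D)

/-- `γ`, restricted to `[0, L]`, is a rectifiable curve of length `L` in `D` from `x` to `y`,
parametrized by arc length. Every rectifiable curve has such a parametrization; unit speed on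
`[0, L]` means that the length of `γ` restricted to `[s, t]` is `t - s`, and includes
continuity. -/
structure IsArcLengthCurve {E : Type u} [MetricSpace E] (D : Set E) (x y : E) (L : ℝ)
    (γ : ℝ → E) : Prop where
  nonneg : 0 ≤ L
  unitSpeed : HasUnitSpeedOn γ (Icc 0 L)
  mapsTo : MapsTo γ (Icc 0 L) D
  source : γ 0 = x
  target : γ L = y

/-- The quasihyperbolic distance `k_D(x, y) = inf_γ ∫_γ |dz| / d_D(z)`, the infimum over all
rectifiable curves `γ` joining `x` and `y` in `D`, where the integral with respect to arc length
is computed in the arc length parametrization. It is finite whenever `D` is a proper domain of a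
normed space and `x, y ∈ D`. -/
noncomputable def qhDist {E : Type u} [MetricSpace E] (D : Set E) (x y : E) : ℝ≥0∞ :=
  ⨅ (L : ℝ) (γ : ℝ → E) (_ : IsArcLengthCurve D x y L γ),
    ∫⁻ t in Icc 0 L, (ENNReal.ofReal (bdryDist D (γ t)))⁻¹

/-- A homeomorphism `f : D → D'` between open sets is `φ`-semisolid if
`k_{D'}(f x, f y) ≤ φ (k_D(x, y))` for all `x, y ∈ D`. Here `D = f.source`, `D' = f.target`; the
notion is only used when these are proper domains, so that both sides are finite. -/
def IsSemisolid {E : Type u} {E' : Type v} [MetricSpace E] [MetricSpace E']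
    (φ : ℝ≥0 ≃ₜ ℝ≥0) (f : OpenPartialHomeomorph E E') : Prop :=
  ∀ x ∈ f.source, ∀ y ∈ f.source,
    qhDist f.target (f x) (f y) ≤ (φ (qhDist f.source x y).toNNReal : ℝ≥0∞)

/-- `f : D → D'` is `φ`-solid if both `f` and its inverse are `φ`-semisolid. -/
def IsSolid {E : Type u} {E' : Type v} [MetricSpace E] [MetricSpace E']
    (φ : ℝ≥0 ≃ₜ ℝ≥0) (f : OpenPartialHomeomorph E E') : Prop :=
  IsSemisolid φ f ∧ IsSemisolid φ f.symm

/-- `f : D → D'` is `φ`-FQC (free `φ`-quasiconformal, i.e. fully `φ`-solid) if for every subdomain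
`G ⊆ D` the restriction `f : G → f(G)` is `φ`-solid. -/
def IsFQC {E : Type u} {E' : Type v} [MetricSpace E] [MetricSpace E']
    (φ : ℝ≥0 ≃ₜ ℝ≥0) (f : OpenPartialHomeomorph E E') : Prop :=
  ∀ (G : Set E) (hG : IsOpen G), IsConnected G → G ⊆ f.source → IsSolid φ (f.restrOpen G hG)

/-- An embedding `f : X → Y` is `η`-quasisymmetric relative to `A ⊆ X` if
`|f y - f x| / |f z - f x| ≤ η (|y - x| / |z - x|)` for all triples `(x, y, z)` of distinct points
of `X` with `x ∈ A` or `{y, z} ⊆ A`. -/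
def IsQSRelativeTo {X : Type u} {Y : Type v} [MetricSpace X] [MetricSpace Y]
    (η : ℝ≥0 ≃ₜ ℝ≥0) (A : Set X) (f : X → Y) : Prop :=
  Topology.IsEmbedding f ∧
    ∀ x y z : X, x ≠ y → x ≠ z → y ≠ z → (x ∈ A ∨ (y ∈ A ∧ z ∈ A)) →
      nndist (f y) (f x) / nndist (f z) (f x) ≤ η (nndist y x / nndist z x)

/-- `f` restricted to the closed ball `B̄(x, r)` is `η`-quasisymmetric relative to the sphere
`S(x, r)`. As the sphere may meet the boundary of the domain of `f`, this means that `f`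
restricted to `B(x, r)` has an extension `g` to `B̄(x, r)` with this property. (Since `g` is
continuous, it is unique, and it agrees with `f` wherever `f` is defined on the sphere.) -/
def IsQSOnClosedBall {E : Type u} {E' : Type v} [NormedAddCommGroup E] [NormedSpace ℝ E]
    [NormedAddCommGroup E'] (η : ℝ≥0 ≃ₜ ℝ≥0) (f : OpenPartialHomeomorph E E') (x : E) (r : ℝ) :
    Prop :=
  ∃ g : Metric.closedBall x r → E',
    (∀ y : Metric.closedBall x r, (y : E) ∈ Metric.ball x r → g y = f y) ∧
    IsQSRelativeTo η {y : Metric.closedBall x r | (y : E) ∈ Metric.sphere x r} g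

end FreeQC

namespace FreeQC

/-! Quasihyperbolic distance is controlled locally. If on every ball B(p, c d_G(p)) a map is
controlled by the quasihyperbolic metric of that ball, then it is controlled by k_G. For nearby
points k_G and the metric of the ball are comparable, and points farther apart are joined by a chain
whose number of links is linear in k_G. This is `qhDist_le_of_local_control`. The resulting gauge
depends only on φ and c, so it suffices to find such balls for f on G and for f⁻¹ on f(G).

For f this is immediate. The ball B(p, c d_G(p)) lies in B_p, where f is φ-FQC, and enlarging the
image domain to f(G) only decreases distances.

For f⁻¹ the ball W = B(f p, c d_{f(G)}(f p)) must lie in f(B_p), so that φ-FQC on B_p applies to the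
subdomain f⁻¹(W). Hence f(B_p) must contain a ball about f p of radius comparable to d_{D'}(f p)
(`bdryDist_target_le`). Otherwise f(S_p) has a point too close to f p, and quasisymmetry makes all
of f(S_p) lie within a small R of f p. But then d_{D'}(f p) ≤ 2R (`bdryDist_le_of_sphere_bound`).
Indeed, if D' contained more, one could repeatedly move to a centre almost at ∂D whose image ball is
half as large. The centres converge to a boundary point of D, while their images converge inside D',
which is impossible for a homeomorphism onto D'. -/

theorem bdryDist_le_add_dist {E : Type u} [MetricSpace E] (G : Set E) (x y : E) : bdryDist G x ≤ bdryDist G y + dist x y :=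
  Metric.infDist_le_infDist_add_dist

/-! ### Distance to the boundary in a normed space. -/

section Distance

variable {E : Type u} [NormedAddCommGroup E] [NormedSpace ℝ E] {G U : Set E} {x y : E}

theorem frontier_nonempty (hG : G ≠ univ) (hx : x ∈ G) : (frontier G).Nonempty :=
  nonempty_frontier_iff.2 ⟨⟨x, hx⟩, hG⟩

/-- A ball is convex, hence connected, so it cannot leave G without meeting the frontier. -/
theorem ball_bdryDist_subset (hGo : IsOpen G) (hx : x ∈ G) :
    Metric.ball x (bdryDist G x) ⊆ G := by
  rcases le_or_gt (bdryDist G x) 0 with h | h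
  · simp [Metric.ball_eq_empty.2 h]
  refine (convex_ball x (bdryDist G x)).isPreconnected.subset_left_of_subset_union hGo
    (isClosed_closure (s := G)).isOpen_compl
    (disjoint_compl_right.mono_right (compl_subset_compl.2 subset_closure)) ?_
    ⟨x, Metric.mem_ball_self h, hx⟩
  intro z hz
  by_contra hc
  simp only [mem_union, mem_compl_iff, not_or, not_not] at hc
  have hzf : z ∈ frontier G := by rw [hGo.frontier_eq]; exact ⟨hc.2, hc.1⟩
  have h1 := Metric.infDist_le_dist_of_mem (x := x) hzf
  rw [Metric.mem_ball, dist_comm] at hz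
  exact absurd hz (not_lt.2 h1)

theorem le_bdryDist (hGo : IsOpen G) (hG : G ≠ univ) (hx : x ∈ G) {r : ℝ}
    (h : Metric.ball x r ⊆ G) : r ≤ bdryDist G x := by
  refine (Metric.le_infDist (frontier_nonempty hG hx)).2 fun z hz => ?_
  by_contra hc
  rw [hGo.frontier_eq] at hz
  exact hz.2 (h (by rw [Metric.mem_ball, dist_comm]; exact not_le.1 hc))

theorem bdryDist_pos (hGo : IsOpen G) (hG : G ≠ univ) (hx : x ∈ G) : 0 < bdryDist G x := by
  obtain ⟨r, hr, h⟩ := Metric.isOpen_iff.1 hGo x hx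
  exact hr.trans_le (le_bdryDist hGo hG hx h)

theorem bdryDist_mono (hUo : IsOpen U) (hGo : IsOpen G) (hG : G ≠ univ) (hUG : U ⊆ G)
    (hx : x ∈ U) : bdryDist U x ≤ bdryDist G x :=
  le_bdryDist hGo hG (hUG hx) ((ball_bdryDist_subset hUo hx).trans hUG)

theorem bdryDist_le_dist (hGo : IsOpen G) (hx : x ∈ G) (hy : y ∉ G) :
    bdryDist G x ≤ dist x y := by
  by_contra hc
  exact hy (ball_bdryDist_subset hGo hx (by rw [Metric.mem_ball, dist_comm]; exact not_le.1 hc))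

theorem exists_mem_frontier_dist_lt (hG : G ≠ univ) (hx : x ∈ G) {r : ℝ}
    (hr : bdryDist G x < r) : ∃ z ∈ frontier G, dist x z < r :=
  (Metric.infDist_lt_iff (frontier_nonempty hG hx)).1 hr

end Distance

/-! ### Arc length curves and the triangle inequality for k. -/

section Curves

variable {E : Type u} [MetricSpace E] {G : Set E} {x y : E} {L : ℝ} {γ : ℝ → E}

theorem edist_le_of_hasUnitSpeedOn {s : Set ℝ} (h : HasUnitSpeedOn γ s) {a b : ℝ}
    (ha : a ∈ s) (hb : b ∈ s) (hab : a ≤ b) : edist (γ a) (γ b) ≤ ENNReal.ofReal (b - a) := by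
  have := h ha hb
  rw [NNReal.coe_one, one_mul] at this
  rw [← this]
  exact eVariationOn.edist_le _ ⟨ha, le_rfl, hab⟩ ⟨hb, hab, le_rfl⟩

theorem dist_le_of_hasUnitSpeedOn {s : Set ℝ} (h : HasUnitSpeedOn γ s) {a b : ℝ}
    (ha : a ∈ s) (hb : b ∈ s) (hab : a ≤ b) : dist (γ a) (γ b) ≤ b - a := by
  have h1 := edist_le_of_hasUnitSpeedOn h ha hb hab
  rw [edist_dist] at h1
  exact (ENNReal.ofReal_le_ofReal_iff (by linarith)).1 h1

theorem hasUnitSpeedOn_of_subset {s t : Set ℝ} (h : HasUnitSpeedOn γ s) (hst : t ⊆ s)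
    (ht : t.OrdConnected) : HasUnitSpeedOn γ t := by
  intro a ha b hb
  have h1 := h (hst ha) (hst hb)
  rw [← h1]
  congr 1
  have : Icc a b ⊆ t := ht.out ha hb
  rw [inter_eq_right.2 this, inter_eq_right.2 (this.trans hst)]

theorem hasUnitSpeedOn_shift {s a b : ℝ} (h : HasUnitSpeedOn γ (Icc (a + s) (b + s))) :
    HasUnitSpeedOn (fun t => γ (t + s)) (Icc a b) := by
  intro p hp q hq
  have h1 := h (x := p + s) ⟨by linarith [hp.1], by linarith [hp.2]⟩ (y := q + s)
    ⟨by linarith [hq.1], by linarith [hq.2]⟩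
  rw [show q + s - (p + s) = q - p by ring] at h1
  rw [← h1]
  have h2 := eVariationOn.comp_eq_of_monotoneOn γ (t := Icc a b ∩ Icc p q) (fun t => t + s)
    (fun _ _ _ _ h => by simpa using h)
  have h3 : (fun t => t + s) '' (Icc a b ∩ Icc p q) = Icc (a + s) (b + s) ∩ Icc (p + s) (q + s) := by
    rw [image_inter (add_left_injective s), image_add_const_Icc, image_add_const_Icc]
  rw [h3] at h2
  exact h2

theorem hasUnitSpeedOn_congr {γ' : ℝ → E} {s : Set ℝ} (h : HasUnitSpeedOn γ s)
    (he : EqOn γ' γ s) : HasUnitSpeedOn γ' s := by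
  intro a ha b hb
  rw [← h ha hb]
  exact eVariationOn.congr (he.mono inter_subset_left)

theorem hasUnitSpeedOn_of_isometry (h : Isometry γ) (a b : ℝ) : HasUnitSpeedOn γ (Icc a b) := by
  have key : ∀ s : Set ℝ, eVariationOn γ s = eVariationOn id s := by
    intro s
    simp only [eVariationOn, h.edist_eq, id]
  refine hasConstantSpeedOnWith_iff_ordered.2 fun p hp q hq hpq => ?_
  rw [key, NNReal.coe_one, one_mul]
  apply le_antisymm
  · exact (monotoneOn_id.eVariationOn_eq hp hq).le
  · refine le_trans ?_ (eVariationOn.edist_le id (s := Icc a b ∩ Icc p q) (x := q) (y := p)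
      ⟨hq, hpq, le_rfl⟩ ⟨hp, le_rfl, hpq⟩)
    rw [edist_dist, Real.dist_eq, id, id, abs_of_nonneg (by linarith)]

theorem setLIntegral_Icc_add (f : ℝ → ℝ≥0∞) (a b s : ℝ) :
    ∫⁻ t in Icc a b, f (t + s) = ∫⁻ t in Icc (a + s) (b + s), f t := by
  have h := (measurePreserving_add_right volume s).setLIntegral_comp_preimage_emb
    (measurableEmbedding_addRight s) f (Icc (a + s) (b + s))
  rw [preimage_add_const_Icc] at h
  simpa using h

theorem qhDist_le_of_curve (h : IsArcLengthCurve G x y L γ) :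
    qhDist G x y ≤ ∫⁻ t in Icc 0 L, (ENNReal.ofReal (bdryDist G (γ t)))⁻¹ :=
  iInf_le_of_le L (iInf_le_of_le γ (iInf_le _ h))

theorem exists_curve_of_qhDist_lt {c : ℝ≥0∞} (h : qhDist G x y < c) :
    ∃ L γ, IsArcLengthCurve G x y L γ ∧
      ∫⁻ t in Icc 0 L, (ENNReal.ofReal (bdryDist G (γ t)))⁻¹ < c := by
  simp only [qhDist, iInf_lt_iff] at h
  obtain ⟨L, γ, h1, h2⟩ := h
  exact ⟨L, γ, h1, h2⟩

theorem IsArcLengthCurve.target_mem (h : IsArcLengthCurve G x y L γ) : y ∈ G :=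
  h.target ▸ h.mapsTo ⟨h.nonneg, le_rfl⟩

theorem IsArcLengthCurve.dist_source_le (h : IsArcLengthCurve G x y L γ) {t : ℝ}
    (ht : t ∈ Icc 0 L) : dist x (γ t) ≤ t := by
  have := dist_le_of_hasUnitSpeedOn h.unitSpeed ⟨le_rfl, h.nonneg⟩ ht ht.1
  rwa [h.source, sub_zero] at this

theorem IsArcLengthCurve.dist_le (h : IsArcLengthCurve G x y L γ) : dist x y ≤ L := by
  have := h.dist_source_le ⟨h.nonneg, le_rfl⟩
  rwa [h.target] at this

theorem isArcLengthCurve_const (hx : x ∈ G) : IsArcLengthCurve G x x 0 fun _ => x where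
  nonneg := le_rfl
  unitSpeed := by
    rw [Icc_self]
    exact hasConstantSpeedOnWith_of_subsingleton _ subsingleton_singleton _
  mapsTo := fun _ _ => hx
  source := rfl
  target := rfl

theorem qhDist_self (hx : x ∈ G) : qhDist G x x = 0 := by
  refine le_antisymm ((qhDist_le_of_curve (isArcLengthCurve_const hx)).trans ?_) bot_le
  simp

theorem qhDist_triangle (G : Set E) (x y z : E) :
    qhDist G x z ≤ qhDist G x y + qhDist G y z := by
  refine ENNReal.le_of_forall_pos_le_add fun ε hε hfin => ?_
  have hfin1 := ENNReal.add_lt_top.1 hfin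
  have hε' : (0 : ℝ≥0∞) < ε / 2 := by simp [hε.ne']
  obtain ⟨L₁, γ₁, h₁, i₁⟩ := exists_curve_of_qhDist_lt
    (ENNReal.lt_add_right hfin1.1.ne hε'.ne')
  obtain ⟨L₂, γ₂, h₂, i₂⟩ := exists_curve_of_qhDist_lt
    (ENNReal.lt_add_right hfin1.2.ne hε'.ne')
  set γ : ℝ → E := fun t => if t ≤ L₁ then γ₁ t else γ₂ (t + -L₁) with hγ
  have e₁ : EqOn γ γ₁ (Icc 0 L₁) := fun t ht => by simp [hγ, ht.2]
  have e₂ : EqOn γ (fun t => γ₂ (t + -L₁)) (Icc L₁ (L₂ + L₁)) := by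
    intro t ht
    rcases ht.1.eq_or_lt with rfl | hlt
    · simp [hγ, h₁.target, h₂.source]
    · simp [hγ, not_le.2 hlt]
  have hcurve : IsArcLengthCurve G x z (L₂ + L₁) γ := by
    refine ⟨add_nonneg h₂.nonneg h₁.nonneg, ?_, ?_, ?_, ?_⟩
    · refine HasUnitSpeedOn.Icc_Icc (y := L₁) (hasUnitSpeedOn_congr h₁.unitSpeed e₁)
        (hasUnitSpeedOn_congr (hasUnitSpeedOn_shift ?_) e₂)
      simpa using h₂.unitSpeed
    · intro t ht
      rcases le_total t L₁ with h | h
      · rw [e₁ ⟨ht.1, h⟩]; exact h₁.mapsTo ⟨ht.1, h⟩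
      · rw [e₂ ⟨h, ht.2⟩]; exact h₂.mapsTo ⟨by linarith, by linarith [ht.2]⟩
    · rw [e₁ ⟨le_rfl, h₁.nonneg⟩, h₁.source]
    · rw [e₂ ⟨by linarith [h₂.nonneg], le_rfl⟩]; simp [h₂.target]
  have hsub : Icc 0 (L₂ + L₁) ⊆ Icc 0 L₁ ∪ Icc L₁ (L₂ + L₁) := by
    intro t ht
    rcases le_total t L₁ with h | h
    exacts [Or.inl ⟨ht.1, h⟩, Or.inr ⟨h, ht.2⟩]
  calc qhDist G x z ≤ ∫⁻ t in Icc 0 (L₂ + L₁), (ENNReal.ofReal (bdryDist G (γ t)))⁻¹ :=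
        qhDist_le_of_curve hcurve
    _ ≤ (∫⁻ t in Icc 0 L₁, (ENNReal.ofReal (bdryDist G (γ t)))⁻¹) +
        ∫⁻ t in Icc L₁ (L₂ + L₁), (ENNReal.ofReal (bdryDist G (γ t)))⁻¹ :=
        (lintegral_mono_set hsub).trans (lintegral_union_le _ _ _)
    _ = (∫⁻ t in Icc 0 L₁, (ENNReal.ofReal (bdryDist G (γ₁ t)))⁻¹) +
        ∫⁻ t in Icc 0 L₂, (ENNReal.ofReal (bdryDist G (γ₂ t)))⁻¹ := by
        congr 1
        · exact setLIntegral_congr_fun measurableSet_Icc fun t ht => by simp only [e₁ ht]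
        · rw [setLIntegral_congr_fun (g := fun t => (ENNReal.ofReal (bdryDist G (γ₂ (t + -L₁))))⁻¹)
            measurableSet_Icc fun t ht => by simp only [e₂ ht]]
          rw [setLIntegral_Icc_add (fun t => (ENNReal.ofReal (bdryDist G (γ₂ t)))⁻¹)]
          simp
    _ ≤ (qhDist G x y + ε / 2) + (qhDist G y z + ε / 2) := add_le_add i₁.le i₂.le
    _ = qhDist G x y + qhDist G y z + ε := by
        rw [add_add_add_comm, ENNReal.add_halves]

end Curves

/-! ### Comparison of k with the norm; finiteness; intermediate points. -/

section NormedSpace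

variable {E : Type u} [NormedAddCommGroup E] [NormedSpace ℝ E] {G U : Set E} {x y : E}

theorem qhDist_mono (hUo : IsOpen U) (hGo : IsOpen G) (hG : G ≠ univ) (hUG : U ⊆ G) (x y : E) :
    qhDist G x y ≤ qhDist U x y := by
  refine le_iInf fun L => le_iInf fun γ => le_iInf fun h => ?_
  have h' : IsArcLengthCurve G x y L γ :=
    ⟨h.nonneg, h.unitSpeed, fun t ht => hUG (h.mapsTo ht), h.source, h.target⟩
  refine (qhDist_le_of_curve h').trans (setLIntegral_mono' measurableSet_Icc fun t ht => ?_)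
  exact ENNReal.inv_le_inv.2 (ENNReal.ofReal_le_ofReal (bdryDist_mono hUo hGo hG hUG (h.mapsTo ht)))

theorem qhDist_le_of_segment {τ : ℝ} (hτ : 0 < τ)
    (hseg : ∀ z ∈ segment ℝ x y, z ∈ G ∧ τ ≤ bdryDist G z) :
    qhDist G x y ≤ ENNReal.ofReal (dist x y / τ) := by
  rcases eq_or_ne x y with rfl | hxy
  · rw [qhDist_self (hseg x (left_mem_segment _ _ _)).1]; exact bot_le
  have hn : 0 < dist x y := dist_pos.2 hxy
  set e : E := (dist x y)⁻¹ • (y - x) with he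
  have hnorm : ‖e‖ = 1 := by
    rw [he, norm_smul, Real.norm_eq_abs, abs_of_pos (inv_pos.2 hn), dist_comm, dist_eq_norm,
      inv_mul_cancel₀]
    rw [← dist_eq_norm, dist_comm]; exact hn.ne'
  have hmem : ∀ t ∈ Icc 0 (dist x y), x + t • e ∈ segment ℝ x y := by
    intro t ht
    rw [segment_eq_image']
    refine ⟨t / dist x y, ⟨div_nonneg ht.1 hn.le, (div_le_one hn).2 ht.2⟩, ?_⟩
    simp only [he, smul_smul, div_eq_mul_inv]
  have hiso : Isometry fun t : ℝ => x + t • e := by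
    refine Isometry.of_dist_eq fun s t => ?_
    rw [dist_add_left, dist_eq_norm, ← sub_smul, norm_smul, hnorm, mul_one, Real.dist_eq,
      Real.norm_eq_abs]
  have hc : IsArcLengthCurve G x y (dist x y) fun t => x + t • e := by
    refine ⟨hn.le, hasUnitSpeedOn_of_isometry hiso _ _, fun t ht => (hseg _ (hmem t ht)).1,
      by simp, ?_⟩
    simp [he, smul_smul, hn.ne']
  refine (qhDist_le_of_curve hc).trans ?_
  calc ∫⁻ t in Icc 0 (dist x y), (ENNReal.ofReal (bdryDist G (x + t • e)))⁻¹
      ≤ ∫⁻ _ in Icc 0 (dist x y), (ENNReal.ofReal τ)⁻¹ :=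
        setLIntegral_mono' measurableSet_Icc fun t ht =>
          ENNReal.inv_le_inv.2 (ENNReal.ofReal_le_ofReal (hseg _ (hmem t ht)).2)
    _ = ENNReal.ofReal (dist x y / τ) := by
        rw [setLIntegral_const, Real.volume_Icc, sub_zero, ENNReal.ofReal_div_of_pos hτ,
          mul_comm, div_eq_mul_inv]

theorem qhDist_le_of_dist_le (hGo : IsOpen G) (hx : x ∈ G) {r : ℝ} (hr : 0 < r)
    (hrG : r ≤ bdryDist G x) (hxy : dist x y ≤ r / 2) :
    qhDist G x y ≤ ENNReal.ofReal (2 * dist x y / r) := by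
  have h := qhDist_le_of_segment (G := G) (x := x) (y := y) (τ := r / 2) (by linarith) ?_
  · convert h using 2
    field_simp
  intro z hz
  have h1 : dist x z ≤ r / 2 := by
    have hb : segment ℝ x y ⊆ Metric.closedBall x (r / 2) :=
      (convex_closedBall x (r / 2)).segment_subset (by simp; linarith)
        (by rwa [Metric.mem_closedBall, dist_comm])
    have := hb hz
    rwa [Metric.mem_closedBall, dist_comm] at this
  refine ⟨ball_bdryDist_subset hGo hx ?_, ?_⟩
  · rw [Metric.mem_ball, dist_comm]; linarith
  · linarith [bdryDist_le_add_dist G x z]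

/-- Within d/2 of x the density is at least 1/(3d/2), where d = d_G(x). A curve of quasihyperbolic
length below 1/3 therefore has no room to travel d/2, and its whole length is at most (3d/2)a. -/
theorem dist_le_of_qhDist_lt (hGo : IsOpen G) (hG : G ≠ univ) (hx : x ∈ G) {a : ℝ}
    (ha : a ≤ 1 / 3) (h : qhDist G x y < ENNReal.ofReal a) :
    dist x y ≤ 3 / 2 * bdryDist G x * a := by
  obtain ⟨L, γ, hγ, hI⟩ := exists_curve_of_qhDist_lt h
  have hd := bdryDist_pos hGo hG hx
  set d := bdryDist G x with hdd
  set m := min L (d / 2) with hm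
  have hm0 : 0 ≤ m := le_min hγ.nonneg (by linarith)
  have hmL : m ≤ L := min_le_left _ _
  have hmd : m ≤ d / 2 := min_le_right _ _
  have h1 : ENNReal.ofReal (m / (3 / 2 * d)) < ENNReal.ofReal a := by
    refine lt_of_le_of_lt ?_ hI
    calc ENNReal.ofReal (m / (3 / 2 * d))
        = ∫⁻ _ in Icc 0 m, (ENNReal.ofReal (3 / 2 * d))⁻¹ := by
          rw [setLIntegral_const, Real.volume_Icc, sub_zero,
            ENNReal.ofReal_div_of_pos (by positivity), div_eq_mul_inv, mul_comm]
      _ ≤ ∫⁻ t in Icc 0 m, (ENNReal.ofReal (bdryDist G (γ t)))⁻¹ := by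
          refine setLIntegral_mono' measurableSet_Icc fun t ht =>
            ENNReal.inv_le_inv.2 (ENNReal.ofReal_le_ofReal ?_)
          have h2 := hγ.dist_source_le (t := t) ⟨ht.1, ht.2.trans hmL⟩
          have h3 := bdryDist_le_add_dist G (γ t) x
          rw [dist_comm] at h3
          linarith [ht.2]
      _ ≤ _ := lintegral_mono_set (Icc_subset_Icc_right hmL)
  have h2 : m / (3 / 2 * d) < a := lt_of_not_ge fun hc => not_le.2 h1 (ENNReal.ofReal_le_ofReal hc)
  rw [div_lt_iff₀ (by positivity)] at h2
  have h3 : m = L := by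
    rcases min_choice L (d / 2) with h | h
    · rw [hm, h]
    -- Here m = d/2, while m < (3d/2)a and a ≤ 1/3.
    · exfalso
      rw [← hm] at h
      nlinarith
  have := hγ.dist_le
  linarith

theorem dist_le_of_qhDist_toReal (hGo : IsOpen G) (hG : G ≠ univ) (hx : x ∈ G)
    (h : qhDist G x y < ENNReal.ofReal (1 / 3)) :
    dist x y ≤ 3 / 2 * bdryDist G x * (qhDist G x y).toReal := by
  have hd := bdryDist_pos hGo hG hx
  have hfin := h.ne_top
  have hk : (qhDist G x y).toReal < 1 / 3 := by
    rwa [← ENNReal.lt_ofReal_iff_toReal_lt hfin]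
  refine le_of_forall_gt_imp_ge_of_dense fun b hb => ?_
  have hc : 0 < 3 / 2 * bdryDist G x := by positivity
  have h1 : (qhDist G x y).toReal < min (b / (3 / 2 * bdryDist G x)) (1 / 3) :=
    lt_min (by rw [lt_div_iff₀ hc]; linarith) hk
  have h2 := dist_le_of_qhDist_lt hGo hG hx (min_le_right _ _)
    ((ENNReal.lt_ofReal_iff_toReal_lt hfin).2 h1)
  refine h2.trans ?_
  calc 3 / 2 * bdryDist G x * min (b / (3 / 2 * bdryDist G x)) (1 / 3)
      ≤ 3 / 2 * bdryDist G x * (b / (3 / 2 * bdryDist G x)) :=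
        mul_le_mul_of_nonneg_left (min_le_left _ _) hc.le
    _ = b := by field_simp

/-- The points at finite and at infinite distance from x both form open sets, because nearby points
are at finite distance. Connectedness leaves only the first. -/
theorem qhDist_ne_top (hGo : IsOpen G) (hGc : IsPreconnected G) (hG : G ≠ univ)
    (hx : x ∈ G) (hy : y ∈ G) : qhDist G x y ≠ ⊤ := by
  have near : ∀ p ∈ G, ∀ q, dist p q ≤ bdryDist G p / 4 → qhDist G p q ≠ ⊤ ∧ qhDist G q p ≠ ⊤ := by
    intro p hp q hpq
    have hd := bdryDist_pos hGo hG hp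
    have hq : q ∈ G := ball_bdryDist_subset hGo hp (by rw [Metric.mem_ball, dist_comm]; linarith)
    have hdq : bdryDist G p * (3 / 4) ≤ bdryDist G q := by
      linarith [bdryDist_le_add_dist G p q]
    exact ⟨ne_top_of_le_ne_top ENNReal.ofReal_ne_top
        (qhDist_le_of_dist_le hGo hp hd le_rfl (by linarith)),
      ne_top_of_le_ne_top ENNReal.ofReal_ne_top
        (qhDist_le_of_dist_le hGo hq (r := bdryDist G p * (3 / 4)) (by linarith) hdq
          (by rw [dist_comm]; linarith))⟩
  have hnhds : ∀ p ∈ G, {q | dist p q ≤ bdryDist G p / 4} ∈ nhds p := by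
    intro p hp
    refine Filter.mem_of_superset
      (Metric.ball_mem_nhds p (half_pos (half_pos (bdryDist_pos hGo hG hp)))) fun q hq => ?_
    rw [Metric.mem_ball, dist_comm] at hq
    show dist p q ≤ bdryDist G p / 4
    linarith
  have hA : IsOpen {q ∈ G | qhDist G x q ≠ ⊤} := by
    refine isOpen_iff_mem_nhds.2 fun p hp => ?_
    filter_upwards [hnhds p hp.1, hGo.mem_nhds hp.1] with q hq hqG
    exact ⟨hqG, ne_top_of_le_ne_top (ENNReal.add_ne_top.2 ⟨hp.2, (near p hp.1 q hq).1⟩)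
      (qhDist_triangle G x p q)⟩
  have hB : IsOpen {q ∈ G | qhDist G x q = ⊤} := by
    refine isOpen_iff_mem_nhds.2 fun p hp => ?_
    filter_upwards [hnhds p hp.1, hGo.mem_nhds hp.1] with q hq hqG
    refine ⟨hqG, by_contra fun hc => ?_⟩
    exact ne_top_of_le_ne_top (ENNReal.add_ne_top.2 ⟨hc, (near p hp.1 q hq).2⟩)
      (qhDist_triangle G x q p) hp.2
  have hsub := hGc.subset_left_of_subset_union hA hB
    (disjoint_left.2 fun q hq hq' => hq.2 hq'.2)
    (fun q hq => by by_cases h : qhDist G x q = ⊤ <;> simp [h, hq])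
    ⟨x, hx, hx, by simp [qhDist_self hx]⟩
  exact (hsub hy).2

/-- A substitute for geodesics, which need not exist: cut an almost optimal curve where its
accumulated quasihyperbolic length equals a. If the whole curve has length at most a, the endpoint y
serves. -/
theorem exists_between_qhDist (hGo : IsOpen G) (hG : G ≠ univ) {a b : ℝ≥0} (hb : 0 < b)
    (h : qhDist G x y < a + b) :
    ∃ z ∈ G, qhDist G x z ≤ a ∧ qhDist G z y < b := by
  obtain ⟨L, γ, hγ, hI⟩ := exists_curve_of_qhDist_lt h
  set w : ℝ → ℝ≥0∞ := fun t => (ENNReal.ofReal (bdryDist G (γ t)))⁻¹ with hw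
  have hpre : ∀ s ∈ Icc 0 L, qhDist G x (γ s) ≤ ∫⁻ t in Icc 0 s, w t := by
    intro s hs
    refine qhDist_le_of_curve ⟨hs.1, ?_, hγ.mapsTo.mono_left (Icc_subset_Icc_right hs.2),
      hγ.source, rfl⟩
    exact hasUnitSpeedOn_of_subset hγ.unitSpeed (Icc_subset_Icc_right hs.2) ordConnected_Icc
  have hsuf : ∀ s ∈ Icc 0 L, qhDist G (γ s) y ≤ ∫⁻ t in Icc s L, w t := by
    intro s hs
    have hc : IsArcLengthCurve G (γ s) y (L - s) fun t => γ (t + s) := by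
      refine ⟨by linarith [hs.2], ?_, ?_, by simp, by simp [hγ.target]⟩
      · refine hasUnitSpeedOn_shift ?_
        refine hasUnitSpeedOn_of_subset hγ.unitSpeed ?_ ordConnected_Icc
        intro t ht; exact ⟨by linarith [ht.1, hs.1], by linarith [ht.2]⟩
      · intro t ht; exact hγ.mapsTo ⟨by linarith [ht.1, hs.1], by linarith [ht.2]⟩
    refine (qhDist_le_of_curve hc).trans_eq ?_
    have := setLIntegral_Icc_add w 0 (L - s) s
    simpa [hw] using this
  rcases le_or_gt (∫⁻ t in Icc 0 L, w t) a with hle | hlt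
  · refine ⟨y, hγ.target_mem, ?_, ?_⟩
    · have := hpre L ⟨hγ.nonneg, le_rfl⟩
      rw [hγ.target] at this
      exact this.trans hle
    · rw [qhDist_self hγ.target_mem]; exact_mod_cast hb
  have hfin : (∫⁻ t in Icc 0 L, w t) ≠ ⊤ :=
    ne_top_of_lt (hI.trans_le le_top)
  have hadd : ∀ s ∈ Icc 0 L,
      (∫⁻ t in Icc 0 s, w t) + (∫⁻ t in Icc s L, w t) = ∫⁻ t in Icc 0 L, w t := by
    intro s hs
    rw [setLIntegral_congr (Ioc_ae_eq_Icc (a := s) (b := L)).symm,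
      ← lintegral_union measurableSet_Ioc, Icc_union_Ioc_eq_Icc hs.1 hs.2]
    exact disjoint_left.2 fun t ht ht' => not_lt.2 ht.2 ht'.1
  have hcont : ContinuousOn γ (Icc 0 L) := by
    have hlip : LipschitzOnWith 1 γ (Icc 0 L) := by
      refine LipschitzOnWith.of_dist_le_mul fun s hs t ht => ?_
      rw [NNReal.coe_one, one_mul]
      rcases le_total s t with h | h
      · rw [Real.dist_eq, abs_sub_comm, abs_of_nonneg (by linarith)]
        exact dist_le_of_hasUnitSpeedOn hγ.unitSpeed hs ht h
      · rw [Real.dist_eq, abs_of_nonneg (by linarith), dist_comm]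
        exact dist_le_of_hasUnitSpeedOn hγ.unitSpeed ht hs h
    exact hlip.continuousOn
  -- The curve is compact, so the density is bounded on it; the accumulated length is then Lipschitz
  -- and the intermediate value theorem applies.
  obtain ⟨t₀, ht₀, hmin⟩ := isCompact_Icc.exists_isMinOn ⟨0, le_rfl, hγ.nonneg⟩
    ((Metric.continuous_infDist_pt (frontier G)).comp_continuousOn hcont)
  have hd₀ : 0 < bdryDist G (γ t₀) := bdryDist_pos hGo hG (hγ.mapsTo ht₀)
  set C : ℝ := (bdryDist G (γ t₀))⁻¹ with hC
  have hwC : ∀ t ∈ Icc 0 L, w t ≤ ENNReal.ofReal C := by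
    intro t ht
    rw [hC, ENNReal.ofReal_inv_of_pos hd₀]
    exact ENNReal.inv_le_inv.2 (ENNReal.ofReal_le_ofReal (hmin ht))
  have hfs : ∀ s ∈ Icc 0 L, (∫⁻ t in Icc 0 s, w t) ≠ ⊤ := fun s hs =>
    ne_top_of_le_ne_top hfin (lintegral_mono_set (Icc_subset_Icc_right hs.2))
  have hstep : ∀ s ∈ Icc 0 L, ∀ t ∈ Icc 0 L, s ≤ t →
      (∫⁻ t in Icc 0 t, w t).toReal - (∫⁻ t in Icc 0 s, w t).toReal ≤ C * (t - s) ∧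
      0 ≤ (∫⁻ t in Icc 0 t, w t).toReal - (∫⁻ t in Icc 0 s, w t).toReal := by
    intro s hs t ht hst
    have h1 : (∫⁻ t in Icc 0 t, w t) ≤ (∫⁻ t in Icc 0 s, w t) + ENNReal.ofReal (C * (t - s)) := by
      rw [← Icc_union_Icc_eq_Icc hs.1 hst]
      refine (lintegral_union_le _ _ _).trans (add_le_add le_rfl ?_)
      calc ∫⁻ u in Icc s t, w u ≤ ∫⁻ _ in Icc s t, ENNReal.ofReal C :=
            setLIntegral_mono' measurableSet_Icc fun u hu =>
              hwC u ⟨hs.1.trans hu.1, hu.2.trans ht.2⟩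
        _ = ENNReal.ofReal (C * (t - s)) := by
            rw [setLIntegral_const, Real.volume_Icc, ENNReal.ofReal_mul (inv_nonneg.2 hd₀.le)]
    have h2 := ENNReal.toReal_mono (ENNReal.add_ne_top.2 ⟨hfs s hs, ENNReal.ofReal_ne_top⟩) h1
    rw [ENNReal.toReal_add (hfs s hs) ENNReal.ofReal_ne_top, ENNReal.toReal_ofReal
      (mul_nonneg (inv_nonneg.2 hd₀.le) (by linarith))] at h2
    have h3 := ENNReal.toReal_mono (hfs t ht)
      (lintegral_mono_set (μ := volume) (f := w)
        (show Icc 0 s ⊆ Icc 0 t from Icc_subset_Icc_right hst))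
    exact ⟨by linarith, by linarith⟩
  have hFc : ContinuousOn (fun s => (∫⁻ t in Icc 0 s, w t).toReal) (Icc 0 L) := by
    have hlip : LipschitzOnWith C.toNNReal (fun s => (∫⁻ t in Icc 0 s, w t).toReal) (Icc 0 L) := by
      refine LipschitzOnWith.of_dist_le_mul fun s hs t ht => ?_
      rw [Real.coe_toNNReal _ (inv_nonneg.2 hd₀.le)]
      rcases le_total s t with h | h
      · have := hstep s hs t ht h
        rw [Real.dist_eq, Real.dist_eq, abs_sub_comm, abs_of_nonneg this.2, abs_sub_comm,
          abs_of_nonneg (by linarith)]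
        exact this.1
      · have := hstep t ht s hs h
        rw [Real.dist_eq, Real.dist_eq, abs_of_nonneg this.2, abs_of_nonneg (by linarith)]
        exact this.1
    exact hlip.continuousOn
  obtain ⟨s, hs, hsa⟩ := intermediate_value_Icc hγ.nonneg hFc
    (show (a : ℝ) ∈ _ from ⟨by simp, by
      have := ENNReal.toReal_mono hfin hlt.le
      simpa using this⟩)
  have hsa' : (∫⁻ t in Icc 0 s, w t) = a := by
    replace hsa : (∫⁻ t in Icc 0 s, w t).toReal = a := hsa
    rw [← ENNReal.ofReal_toReal (hfs s hs), hsa, ENNReal.ofReal_coe_nnreal]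
  refine ⟨γ s, hγ.mapsTo hs, (hpre s hs).trans_eq hsa', ?_⟩
  have h1 := hadd s hs
  rw [hsa'] at h1
  rw [← h1] at hI
  exact (hsuf s hs).trans_lt (lt_of_add_lt_add_left hI)

end NormedSpace

/-! ### Gauge functions. -/

section Gauge

theorem strictMono_homeomorph (φ : ℝ≥0 ≃ₜ ℝ≥0) : StrictMono φ := by
  refine (φ.continuous.strictMono_of_inj φ.injective).resolve_right fun h => ?_
  obtain ⟨t, ht⟩ := φ.surjective (φ 0 + 1)
  have := h.antitone (show 0 ≤ t from zero_le)
  rw [ht] at this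
  exact absurd this (by simp)

theorem homeomorph_zero (φ : ℝ≥0 ≃ₜ ℝ≥0) : φ 0 = 0 := by
  obtain ⟨t, ht⟩ := φ.surjective 0
  exact le_antisymm (((strictMono_homeomorph φ).monotone (show 0 ≤ t from zero_le)).trans_eq ht)
    zero_le

theorem exists_homeomorph_of_strictMono {g : ℝ≥0 → ℝ≥0} (hg : Continuous g) (hm : StrictMono g)
    (h0 : g 0 = 0) (hle : ∀ t, t ≤ g t) : ∃ ψ : ℝ≥0 ≃ₜ ℝ≥0, ∀ t, ψ t = g t := by
  have hs : Function.Surjective g := fun c =>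
    mem_range_of_exists_le_of_exists_ge hg ⟨0, h0.trans_le zero_le⟩ ⟨c, hle c⟩
  exact ⟨(StrictMono.orderIsoOfSurjective g hm hs).toHomeomorph, fun _ => rfl⟩

/-- The term φ(at) serves short distances and bt serves chains; the last summand t makes the sum
strictly increasing, unbounded and at least t. -/
theorem exists_homeomorph_dominating (φ : ℝ≥0 ≃ₜ ℝ≥0) (a b : ℝ≥0) :
    ∃ ψ : ℝ≥0 ≃ₜ ℝ≥0, ∀ t, ψ t = φ (a * t) + b * t + t := by
  have hmul : ∀ c : ℝ≥0, Monotone fun t => c * t := fun c s t h => mul_le_mul_right h c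
  refine exists_homeomorph_of_strictMono (g := fun t => φ (a * t) + b * t + t)
    (((φ.continuous.comp (continuous_const.mul continuous_id)).add
      (continuous_const.mul continuous_id)).add continuous_id) ?_ ?_ ?_
  · exact ((((strictMono_homeomorph φ).monotone.comp (hmul a)).add (hmul b))).add_strictMono
      strictMono_id
  · simp [homeomorph_zero]
  · exact fun t => le_add_self

end Gauge

/-! ### Chains and the passage from local to global control. -/

section Chains

variable {E : Type u} [NormedAddCommGroup E] [NormedSpace ℝ E]
  {E' : Type v} [MetricSpace E'] {G : Set E} {G' : Set E'}

theorem bdryDist_half_le (hGo : IsOpen G) (hG : G ≠ univ) {x y : E} (hx : x ∈ G)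
    (h : qhDist G x y ≤ (1 / 4 : ℝ≥0)) : bdryDist G x / 2 ≤ bdryDist G y := by
  have h1 : ((1 / 4 : ℝ≥0) : ℝ≥0∞) < ENNReal.ofReal (1 / 3) := by
    rw [ENNReal.ofReal, ENNReal.coe_lt_coe, ← NNReal.coe_lt_coe, Real.coe_toNNReal _ (by norm_num)]
    norm_num
  have := dist_le_of_qhDist_lt hGo hG hx le_rfl (h.trans_lt h1)
  linarith [bdryDist_le_add_dist G x y]

/-- Splits one link off a chain. Counting links as n + 1 keeps the remaining length positive. -/
theorem exists_step (hGo : IsOpen G) (hG : G ≠ univ) {x y : E} {t : ℝ≥0} (ht : 0 < t) {n : ℕ}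
    (h : qhDist G x y < ((n + 1 + 1 : ℕ) * t : ℝ≥0)) :
    ∃ z ∈ G, qhDist G x z ≤ t ∧ qhDist G z y < ((n + 1 : ℕ) * t : ℝ≥0) := by
  refine exists_between_qhDist hGo hG (by positivity) (h.trans_eq ?_)
  rw [← ENNReal.coe_add]
  congr 1
  push_cast
  ring

/-- Each link of length 1/4 at most halves the distance to the boundary. -/
theorem bdryDist_le_of_qhDist_lt (hGo : IsOpen G) (hG : G ≠ univ) (n : ℕ) {x y : E} (hx : x ∈ G)
    (h : qhDist G x y < ((n + 1 : ℕ) * (1 / 4) : ℝ≥0)) :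
    bdryDist G x / 2 ^ (n + 1) ≤ bdryDist G y := by
  induction n generalizing x with
  | zero => simpa using bdryDist_half_le hGo hG hx (by simpa using h.le)
  | succ n ih =>
    obtain ⟨z, hz, h1, h2⟩ := exists_step hGo hG (by norm_num) h
    have h3 := bdryDist_half_le hGo hG hx h1
    refine le_trans ?_ (ih hz h2)
    rw [pow_succ 2 (n + 1), ← div_div, div_right_comm]
    gcongr

theorem exists_bdryDist_lower_bound (hGo : IsOpen G) (hG : G ≠ univ) {x : E} (hx : x ∈ G)
    (M : ℝ≥0) : ∃ δ > 0, ∀ y, qhDist G x y ≤ M → δ ≤ bdryDist G y := by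
  obtain ⟨n, hn⟩ := exists_nat_gt (M * 4)
  refine ⟨bdryDist G x / 2 ^ (n + 1), div_pos (bdryDist_pos hGo hG hx) (by positivity),
    fun y hy => bdryDist_le_of_qhDist_lt hGo hG n hx (hy.trans_lt ?_)⟩
  rw [ENNReal.coe_lt_coe]
  have h1 : M * 4 < ((n + 1 : ℕ) : ℝ≥0) := hn.trans (by simp)
  rw [mul_one_div, lt_div_iff₀ (by norm_num)]
  exact h1

theorem qhDist_le_of_chain (hGo : IsOpen G) (hG : G ≠ univ) {f : E → E'} {t M : ℝ≥0} (ht : 0 < t)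
    (hf : ∀ x ∈ G, ∀ y ∈ G, qhDist G x y ≤ t → qhDist G' (f x) (f y) ≤ M) (n : ℕ) {x y : E}
    (hx : x ∈ G) (hy : y ∈ G) (h : qhDist G x y < ((n + 1 : ℕ) * t : ℝ≥0)) :
    qhDist G' (f x) (f y) ≤ ((n + 1 : ℕ) * M : ℝ≥0) := by
  induction n generalizing x with
  | zero => simpa using hf x hx y hy (by simpa using h.le)
  | succ n ih =>
    obtain ⟨z, hz, h1, h2⟩ := exists_step hGo hG ht h
    refine (qhDist_triangle G' (f x) (f z) (f y)).trans
      ((add_le_add (hf x hx z hz h1) (ih hz h2)).trans_eq ?_)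
    rw [← ENNReal.coe_add]
    congr 1
    push_cast
    ring

/-- A map which, on the balls `B(x, c d_G(x))`, is controlled by the quasihyperbolic metric of
the ball is controlled by the quasihyperbolic metric of `G`. -/
theorem qhDist_le_of_local_control (φ : ℝ≥0 ≃ₜ ℝ≥0) {c : ℝ≥0} (hc : 0 < c) (hc1 : c ≤ 1)
    {ψ : ℝ≥0 ≃ₜ ℝ≥0}
    (hψ : ∀ t, ψ t = φ (3 / c * t) + 2 * φ (3 / c * (c / 4)) / (c / 4) * t + t)
    (hGo : IsOpen G) (hGc : IsPreconnected G) (hG : G ≠ univ) {f : E → E'}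
    (hf : ∀ x ∈ G, ∀ y ∈ Metric.ball x (c * bdryDist G x),
      qhDist G' (f x) (f y) ≤ φ (qhDist (Metric.ball x (c * bdryDist G x)) x y).toNNReal)
    {x y : E} (hx : x ∈ G) (hy : y ∈ G) :
    qhDist G' (f x) (f y) ≤ ψ (qhDist G x y).toNNReal := by
  have hφ := (strictMono_homeomorph φ).monotone
  have hcR : (0 : ℝ) < c := hc
  have hc1R : (c : ℝ) ≤ 1 := hc1
  -- Here |x - y| ≤ (3/2) d k ≤ cd/2, and in the ball of radius cd the distance is at most 2|x -
  -- y|/(cd) ≤ 3k/c.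
  have hsmall : ∀ x ∈ G, ∀ y ∈ G, qhDist G x y ≤ (c / 4 : ℝ≥0) →
      qhDist G' (f x) (f y) ≤ φ (3 / c * (qhDist G x y).toNNReal) := by
    intro x hx y hy hk
    have hd := bdryDist_pos hGo hG hx
    have hfin : qhDist G x y ≠ ⊤ := ne_top_of_le_ne_top ENNReal.coe_ne_top hk
    have hkR : (qhDist G x y).toReal ≤ c / 4 := by
      simpa using ENNReal.toReal_mono ENNReal.coe_ne_top hk
    have h1 := dist_le_of_qhDist_toReal hGo hG hx (y := y)
      ((ENNReal.lt_ofReal_iff_toReal_lt hfin).2 (by linarith))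
    have h2 : dist x y ≤ c * bdryDist G x / 2 := by
      refine h1.trans ?_
      nlinarith [mul_pos hcR hd]
    have hr : 0 < c * bdryDist G x := mul_pos hcR hd
    have hmem : y ∈ Metric.ball x (c * bdryDist G x) := by
      rw [Metric.mem_ball, dist_comm]; linarith
    have hballG : Metric.ball x (c * bdryDist G x) ⊆ G :=
      (Metric.ball_subset_ball (mul_le_of_le_one_left hd.le hc1R)).trans
        (ball_bdryDist_subset hGo hx)
    have hballne : Metric.ball x (c * bdryDist G x) ≠ univ := fun h =>
      hG (univ_subset_iff.1 (h ▸ hballG))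
    refine (hf x hx y hmem).trans (ENNReal.coe_le_coe.2 (hφ ?_))
    have h3 := qhDist_le_of_dist_le Metric.isOpen_ball (Metric.mem_ball_self hr) hr
      (le_bdryDist Metric.isOpen_ball hballne (Metric.mem_ball_self hr) subset_rfl) h2
    have h4 := ENNReal.toReal_mono ENNReal.ofReal_ne_top h3
    rw [ENNReal.toReal_ofReal (by positivity)] at h4
    rw [← NNReal.coe_le_coe]
    push_cast
    refine h4.trans ?_
    rw [div_le_iff₀ hr]
    have : 3 / (c : ℝ) * (qhDist G x y).toReal * (c * bdryDist G x) =
        2 * (3 / 2 * bdryDist G x * (qhDist G x y).toReal) := by field_simp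
    rw [this]
    linarith
  have hfin := qhDist_ne_top hGo hGc hG hx hy
  rw [hψ]
  rcases le_total (qhDist G x y) (c / 4 : ℝ≥0) with hk | hk
  · refine (hsmall x hx y hy hk).trans (ENNReal.coe_le_coe.2 ?_)
    rw [add_assoc]
    exact le_self_add
  have ht : 0 < c / 4 := div_pos hc (by norm_num)
  set k := (qhDist G x y).toNNReal with hkdef
  have hkk : qhDist G x y = k := (ENNReal.coe_toNNReal hfin).symm
  have hk' : c / 4 ≤ k := by rw [hkk] at hk; exact_mod_cast hk
  have hlt : qhDist G x y < ((⌊k / (c / 4)⌋₊ + 1 : ℕ) * (c / 4) : ℝ≥0) := by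
    rw [hkk, ENNReal.coe_lt_coe, ← div_lt_iff₀ ht]
    push_cast
    exact Nat.lt_floor_add_one _
  have hchain := qhDist_le_of_chain hGo hG (G' := G') (f := f) ht
    (M := φ (3 / c * (c / 4))) (fun x hx y hy h => (hsmall x hx y hy h).trans
      (ENNReal.coe_le_coe.2 (hφ (mul_le_mul_right (ENNReal.toNNReal_mono ENNReal.coe_ne_top h) _))))
    _ hx hy hlt
  refine hchain.trans (ENNReal.coe_le_coe.2 ?_)
  refine le_trans ?_ (le_self_add.trans' (le_add_self (a := 2 * φ (3 / c * (c / 4)) / (c / 4) * k)))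
  -- Since k ≥ c/4, the extra link from rounding up costs at most a factor 2.
  have hfl : ((⌊k / (c / 4)⌋₊ + 1 : ℕ) : ℝ≥0) ≤ 2 * (k / (c / 4)) := by
    push_cast
    rw [two_mul]
    exact add_le_add (Nat.floor_le zero_le) ((one_le_div ht).2 hk')
  calc ((⌊k / (c / 4)⌋₊ + 1 : ℕ) : ℝ≥0) * φ (3 / c * (c / 4))
      ≤ 2 * (k / (c / 4)) * φ (3 / c * (c / 4)) := mul_le_mul_left hfl _
    _ = 2 * φ (3 / c * (c / 4)) / (c / 4) * k := by ring

end Chains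

/-! ### Solidity of restrictions in terms of images. -/

section Restriction

variable {E : Type u} {E' : Type v}

theorem restrOpen_target_eq_image [TopologicalSpace E] [TopologicalSpace E']
    (f : OpenPartialHomeomorph E E') {G : Set E} (hGo : IsOpen G)
    (hG : G ⊆ f.source) : (f.restrOpen G hGo).target = f '' G := by
  rw [← OpenPartialHomeomorph.image_source_eq_target, OpenPartialHomeomorph.restrOpen_source,
    inter_eq_right.2 hG, OpenPartialHomeomorph.coe_restrOpen]

theorem isSolid_restrOpen_iff [MetricSpace E] [MetricSpace E'] {φ : ℝ≥0 ≃ₜ ℝ≥0}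
    {f : OpenPartialHomeomorph E E'} {G : Set E} (hGo : IsOpen G) (hG : G ⊆ f.source) :
    IsSolid φ (f.restrOpen G hGo) ↔ ∀ x ∈ G, ∀ y ∈ G,
      qhDist (f '' G) (f x) (f y) ≤ φ (qhDist G x y).toNNReal ∧
      qhDist G x y ≤ φ (qhDist (f '' G) (f x) (f y)).toNNReal := by
  have hs : (f.restrOpen G hGo).source = G := by
    rw [OpenPartialHomeomorph.restrOpen_source, inter_eq_right.2 hG]
  have ht := restrOpen_target_eq_image f hGo hG
  unfold IsSolid IsSemisolid
  rw [OpenPartialHomeomorph.symm_source, OpenPartialHomeomorph.symm_target, hs, ht,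
    OpenPartialHomeomorph.coe_restrOpen, OpenPartialHomeomorph.coe_restrOpen_symm]
  constructor
  · rintro ⟨h1, h2⟩ x hx y hy
    refine ⟨h1 x hx y hy, ?_⟩
    have := h2 (f x) (mem_image_of_mem _ hx) (f y) (mem_image_of_mem _ hy)
    rwa [f.left_inv (hG hx), f.left_inv (hG hy)] at this
  · refine fun h => ⟨fun x hx y hy => (h x hx y hy).1, ?_⟩
    rintro _ ⟨x, hx, rfl⟩ _ ⟨y, hy, rfl⟩
    rw [f.left_inv (hG hx), f.left_inv (hG hy)]
    exact (h x hx y hy).2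

theorem IsFQC.qhDist_le [MetricSpace E] [MetricSpace E'] {φ : ℝ≥0 ≃ₜ ℝ≥0}
    {f : OpenPartialHomeomorph E E'} {B : Set E} {hBo : IsOpen B}
    (h : IsFQC φ (f.restrOpen B hBo)) {U : Set E} (hUo : IsOpen U) (hUc : IsConnected U)
    (hU : U ⊆ f.source) (hUB : U ⊆ B) {x y : E} (hx : x ∈ U) (hy : y ∈ U) :
    qhDist (f '' U) (f x) (f y) ≤ φ (qhDist U x y).toNNReal ∧
      qhDist U x y ≤ φ (qhDist (f '' U) (f x) (f y)).toNNReal :=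
  have hs : U ⊆ (f.restrOpen B hBo).source := by
    rw [OpenPartialHomeomorph.restrOpen_source]; exact subset_inter hU hUB
  (isSolid_restrOpen_iff hUo hs).1 (h U hUo hUc hs) x hx y hy

end Restriction

theorem exists_pos_homeomorph_le (η : ℝ≥0 ≃ₜ ℝ≥0) {e : ℝ≥0} (he : 0 < e) :
    ∃ δ : ℝ≥0, 0 < δ ∧ δ ≤ 1 / 2 ∧ η δ ≤ e := by
  refine ⟨min (η.symm e) (1 / 2), lt_min ?_ (by norm_num), min_le_right _ _, ?_⟩
  · refine pos_iff_ne_zero.2 fun h => he.ne' ?_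
    rw [← η.apply_symm_apply e, h, homeomorph_zero]
  · calc η (min (η.symm e) (1 / 2)) ≤ η (η.symm e) :=
        (strictMono_homeomorph η).monotone (min_le_left _ _)
      _ = e := η.apply_symm_apply e

/-- The point lies on the ray from x through y, possibly beyond y. -/
theorem exists_dist_eq_on_line {E : Type u} [NormedAddCommGroup E] [NormedSpace ℝ E] {x y : E}
    (hxy : x ≠ y) {r : ℝ} (hr : 0 ≤ r) : ∃ p, dist p x = r ∧ dist p y = |dist x y - r| := by
  have hd : 0 < dist x y := dist_pos.2 hxy
  refine ⟨AffineMap.lineMap x y (r / dist x y), ?_, ?_⟩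
  · rw [dist_lineMap_left, Real.norm_eq_abs, abs_of_nonneg (by positivity), div_mul_cancel₀ _ hd.ne']
  · rw [dist_lineMap_right, Real.norm_eq_abs, ← abs_of_pos hd, ← abs_mul, abs_of_pos hd, sub_mul,
      div_mul_cancel₀ _ hd.ne', one_mul]

/-! ### Quasisymmetric extensions to closed balls. -/

section Extension

variable {E : Type u} [NormedAddCommGroup E] [NormedSpace ℝ E]
  {E' : Type v} [NormedAddCommGroup E'] {η : ℝ≥0 ≃ₜ ℝ≥0} {f : OpenPartialHomeomorph E E'}
  {g : E → E'} {x : E} {r : ℝ}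

/-- The properties used of an extension of `f` to the closed ball `B̄(x, r)` that is
quasisymmetric relative to the sphere. -/
structure IsQSExtension (η : ℝ≥0 ≃ₜ ℝ≥0) (f : OpenPartialHomeomorph E E') (x : E) (r : ℝ)
    (g : E → E') : Prop where
  continuousOn : ContinuousOn g (Metric.closedBall x r)
  eqOn : EqOn g f (Metric.ball x r)
  center : ∀ p ∈ Metric.sphere x r, ∀ q ∈ Metric.sphere x r,
    dist (g q) (g x) ≤ max 1 (η 1) * dist (g p) (g x)
  sphere : ∀ p ∈ Metric.sphere x r, ∀ q ∈ Metric.closedBall x r, q ≠ x → ∀ t : ℝ≥0,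
    dist q p ≤ t * r → dist (g q) (g p) ≤ η t * dist (g x) (g p)

theorem IsQSRelativeTo.dist_le {X : Type*} {Y : Type*} [MetricSpace X] [MetricSpace Y]
    {A : Set X} {g : X → Y} (h : IsQSRelativeTo η A g) {x y z : X} (hxy : x ≠ y) (hxz : x ≠ z)
    (hyz : y ≠ z) (hA : x ∈ A ∨ (y ∈ A ∧ z ∈ A)) {t : ℝ≥0} (ht : dist y x ≤ t * dist z x) :
    dist (g y) (g x) ≤ η t * dist (g z) (g x) := by
  have hz : 0 < nndist z x := pos_iff_ne_zero.2 fun h0 => hxz (nndist_eq_zero.1 h0).symm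
  have hgz : 0 < nndist (g z) (g x) :=
    pos_iff_ne_zero.2 fun h0 => hxz (h.1.injective (nndist_eq_zero.1 h0)).symm
  have ht' : nndist y x / nndist z x ≤ t := by
    rw [div_le_iff₀ hz]; exact_mod_cast ht
  have := (h.2 x y z hxy hxz hyz hA).trans ((strictMono_homeomorph η).monotone ht')
  rw [div_le_iff₀ hgz] at this
  exact_mod_cast this

theorem IsQSOnClosedBall.exists_extension (hr : 0 < r) (h : IsQSOnClosedBall η f x r) :
    ∃ g : E → E', IsQSExtension η f x r g := by
  obtain ⟨g, hg, hqs⟩ := h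
  have hx : x ∈ Metric.closedBall x r := Metric.mem_closedBall_self hr.le
  have hsub := Metric.sphere_subset_closedBall (x := x) (ε := r)
  classical
  -- The value 0 outside the closed ball is never used.
  refine ⟨fun y => if hy : y ∈ Metric.closedBall x r then g ⟨y, hy⟩ else 0, ?_, ?_, ?_, ?_⟩
  · rw [continuousOn_iff_continuous_domRestrict]
    refine hqs.1.continuous.congr fun y => ?_
    rw [domRestrict_apply, dif_pos y.2]
  · intro y hy
    have hy' := Metric.ball_subset_closedBall hy
    simp only [dif_pos hy']
    exact hg _ hy
  · intro p hp q hq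
    simp only [dif_pos (hsub hp), dif_pos (hsub hq), dif_pos hx]
    -- Quasisymmetry speaks of distinct points only; the 1 in the maximum covers q = p.
    rcases eq_or_ne q p with rfl | hqp
    · exact le_mul_of_one_le_left dist_nonneg (by exact_mod_cast le_max_left 1 (η 1))
    have hne : ∀ s ∈ Metric.sphere x r, x ≠ s := by
      rintro s hs rfl
      rw [Metric.mem_sphere, dist_self] at hs
      exact hr.ne hs
    refine (hqs.dist_le (x := ⟨x, hx⟩) (y := ⟨q, hsub hq⟩) (z := ⟨p, hsub hp⟩) (t := 1)
      (by simpa [Subtype.ext_iff] using hne q hq) (by simpa [Subtype.ext_iff] using hne p hp)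
      (by simpa [Subtype.ext_iff] using hqp) (Or.inr ⟨hq, hp⟩) ?_).trans ?_
    · rw [Metric.mem_sphere] at hp hq
      simp [Subtype.dist_eq, hp, hq]
    · exact mul_le_mul_of_nonneg_right (by exact_mod_cast le_max_right 1 (η 1)) dist_nonneg
  · intro p hp q hq hqx t ht
    simp only [dif_pos (hsub hp), dif_pos hq, dif_pos hx]
    rcases eq_or_ne q p with rfl | hqp
    · rw [dist_self]; positivity
    have hpx : p ≠ x := by
      rintro rfl
      rw [Metric.mem_sphere, dist_self] at hp
      exact hr.ne hp
    refine hqs.dist_le (x := ⟨p, hsub hp⟩) (y := ⟨q, hq⟩) (z := ⟨x, hx⟩)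
      (by simpa [Subtype.ext_iff] using hqp.symm) (by simpa [Subtype.ext_iff] using hpx)
      (by simpa [Subtype.ext_iff] using hqx) (Or.inl hp) ?_
    rw [Metric.mem_sphere, dist_comm] at hp
    simpa [Subtype.dist_eq, hp] using ht

variable (h : IsQSExtension η f x r g) (hr : 0 < r) (hB : Metric.ball x r ⊆ f.source) {p : E}
  (hp : p ∈ Metric.closedBall x r)
include h hr hp

theorem IsQSExtension.tendsto :
    (nhdsWithin p (Metric.ball x r)).NeBot ∧
      Filter.Tendsto f (nhdsWithin p (Metric.ball x r)) (nhds (g p)) := by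
  refine ⟨mem_closure_iff_nhdsWithin_neBot.1 (by rwa [closure_ball x hr.ne']), ?_⟩
  refine (((h.continuousOn p hp).mono Metric.ball_subset_closedBall).tendsto).congr' ?_
  filter_upwards [self_mem_nhdsWithin] with y hy using h.eqOn hy

theorem IsQSExtension.eq_of_mem (hpD : p ∈ f.source) : g p = f p := by
  obtain ⟨_, ht⟩ := h.tendsto hr hp
  exact tendsto_nhds_unique ht ((f.continuousAt hpD).tendsto.mono_left nhdsWithin_le_nhds)

include hB in
-- As y in the ball tends to p, f(y) tends to g(p) in the target, so y = f⁻¹(f(y)) tends to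
-- f⁻¹(g(p)). This limit is p.
theorem IsQSExtension.mem_source (hgp : g p ∈ f.target) : p ∈ f.source := by
  obtain ⟨_, ht⟩ := h.tendsto hr hp
  have h1 : Filter.Tendsto (fun y => f.symm (f y)) (nhdsWithin p (Metric.ball x r))
      (nhds (f.symm (g p))) := (f.symm.continuousAt hgp).tendsto.comp ht
  have h2 : Filter.Tendsto (fun y => f.symm (f y)) (nhdsWithin p (Metric.ball x r)) (nhds p) := by
    refine Filter.Tendsto.congr' ?_ (tendsto_nhdsWithin_of_tendsto_nhds Filter.tendsto_id)
    filter_upwards [self_mem_nhdsWithin] with y hy using (f.left_inv (hB hy)).symm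
  rw [tendsto_nhds_unique h2 h1]
  exact f.map_target hgp

end Extension

/-! ### Boundary points of the image of a ball. -/

section Images

variable {E : Type u} [NormedAddCommGroup E] [NormedSpace ℝ E]
  {E' : Type v} [NormedAddCommGroup E'] [NormedSpace ℝ E']
  {φ η : ℝ≥0 ≃ₜ ℝ≥0} {f : OpenPartialHomeomorph E E'} {g : E → E'} {x : E} {r : ℝ}

/-- Every boundary point of the image of a ball is a limit of image points of its sphere. -/
theorem IsQSExtension.exists_sphere_dist_lt [Nontrivial E] (h : IsQSExtension η f x r g)
    (hr : 0 < r) (hB : Metric.ball x r ⊆ f.source) (himg : f '' Metric.ball x r ≠ univ)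
    (hφ : ∀ y ∈ Metric.ball x r, qhDist (f '' Metric.ball x r) (f x) (f y) ≤
      φ (qhDist (Metric.ball x r) x y).toNNReal)
    {w : E'} (hw : w ∈ frontier (f '' Metric.ball x r)) {ε : ℝ} (hε : 0 < ε) :
    ∃ s ∈ Metric.sphere x r, dist (g s) w < ε := by
  obtain ⟨s₁, hs₁⟩ := NormedSpace.sphere_nonempty (x := x).2 hr.le
  have hxB : x ∈ Metric.ball x r := Metric.mem_ball_self hr
  -- K bounds the image of the whole sphere; closed balls need not be compact, so τ is chosen to
  -- make η(τ)K small instead.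
  set K : ℝ := max 1 (η 1) * dist (g s₁) (g x) with hK
  have hK0 : 0 ≤ K := mul_nonneg (zero_le_one.trans (by exact_mod_cast le_max_left 1 (η 1)))
    dist_nonneg
  obtain ⟨τ, hτ0, hτ1, hτ⟩ := exists_pos_homeomorph_le η
    (e := (ε / (4 * (K + 1))).toNNReal) (Real.toNNReal_pos.2 (by positivity))
  have hτR : (0 : ℝ) < τ := hτ0
  have hτ1R : (τ : ℝ) ≤ 1 / 2 := by exact_mod_cast hτ1
  have hητ : (η τ : ℝ) * K ≤ ε / 4 := by
    have h1 : (η τ : ℝ) ≤ ε / (4 * (K + 1)) := by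
      have := NNReal.coe_le_coe.2 hτ
      rwa [Real.coe_toNNReal _ (by positivity)] at this
    calc (η τ : ℝ) * K ≤ ε / (4 * (K + 1)) * (K + 1) :=
          mul_le_mul h1 (by linarith) hK0 (by positivity)
      _ = ε / 4 := by field_simp
  have hUo : IsOpen (f '' Metric.ball x r) := f.isOpen_image_of_subset_source Metric.isOpen_ball hB
  obtain ⟨δ, hδ, hδ'⟩ := exists_bdryDist_lower_bound hUo himg (mem_image_of_mem f hxB)
    (φ (τ⁻¹))
  obtain ⟨_, ⟨y, hy, rfl⟩, hyw⟩ := Metric.mem_closure_iff.1 hw.1 (min (ε / 2) δ)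
    (lt_min (by linarith) hδ)
  have hyr : dist x y < r := by rwa [Metric.mem_ball, dist_comm] at hy
  -- A point y of the smaller ball has k(x, y) ≤ 1/τ, so its image stays at least δ away from the
  -- frontier, whereas f(y) is closer than δ to w.
  have hfar : (1 - τ) * r < dist x y := by
    by_contra! hc
    have hballne : Metric.ball x r ≠ univ := fun hu => by
      have hs := hu ▸ mem_univ s₁
      rw [Metric.mem_ball] at hs
      exact hs.ne hs₁
    have hseg : ∀ z ∈ segment ℝ x y, z ∈ Metric.ball x r ∧
        τ * r ≤ bdryDist (Metric.ball x r) z := by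
      intro z hz
      have hzx : dist z x ≤ (1 - τ) * r :=
        (convex_closedBall x ((1 - τ) * r)).segment_subset
          (Metric.mem_closedBall_self (by nlinarith)) (by rwa [Metric.mem_closedBall, dist_comm]) hz
      have hzB : z ∈ Metric.ball x r := by
        rw [Metric.mem_ball]; nlinarith [mul_pos hτR hr]
      refine ⟨hzB, ?_⟩
      have h1 := bdryDist_le_add_dist (Metric.ball x r) x z
      have h2 : r ≤ bdryDist (Metric.ball x r) x :=
        le_bdryDist Metric.isOpen_ball hballne hxB subset_rfl
      rw [dist_comm] at h1
      linarith
    have hk := qhDist_le_of_segment (mul_pos hτR hr) hseg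
    have hkN : (qhDist (Metric.ball x r) x y).toNNReal ≤ τ⁻¹ := by
      have h1 := ENNReal.toReal_mono ENNReal.ofReal_ne_top hk
      rw [ENNReal.toReal_ofReal (by positivity)] at h1
      rw [← NNReal.coe_le_coe]
      refine h1.trans ?_
      rw [NNReal.coe_inv, div_le_iff₀ (mul_pos hτR hr), inv_mul_cancel_left₀ hτR.ne']
      exact hyr.le
    have h1 := hδ' (f y) ((hφ y hy).trans
      (ENNReal.coe_le_coe.2 ((strictMono_homeomorph φ).monotone hkN)))
    have h2 : bdryDist (f '' Metric.ball x r) (f y) ≤ dist (f y) w :=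
      Metric.infDist_le_dist_of_mem hw
    rw [dist_comm] at h2
    exact absurd (h1.trans h2) (not_le.2 (hyw.trans_le (min_le_right _ _)))
  have hxy : x ≠ y := by
    rintro rfl
    rw [dist_self] at hfar
    nlinarith
  -- The radial projection of y to the sphere, at distance less than τr.
  obtain ⟨s, hsx, hsy⟩ := exists_dist_eq_on_line hxy hr.le
  rw [abs_of_neg (by linarith)] at hsy
  refine ⟨s, hsx, ?_⟩
  have h1 := h.sphere s hsx y (Metric.ball_subset_closedBall hy) hxy.symm τ
    (by rw [dist_comm]; linarith)
  have h2 := h.center s₁ hs₁ s hsx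
  have h3 : dist (g y) (g s) ≤ ε / 4 := by
    refine (h1.trans ?_).trans hητ
    rw [dist_comm (g x)]
    exact mul_le_mul_of_nonneg_left h2 (η τ).2
  rw [h.eqOn hy] at h3
  have h4 : dist (f y) w < ε / 2 := by
    rw [dist_comm]; exact hyw.trans_le (min_le_left _ _)
  have h5 := dist_triangle_left (g s) w (f y)
  linarith

end Images

/-! ### Size of the images of the balls B_x. -/

section Distortion

variable {E : Type u} [NormedAddCommGroup E] [NormedSpace ℝ E]
  {E' : Type v} [NormedAddCommGroup E'] {η : ℝ≥0 ≃ₜ ℝ≥0} {f : OpenPartialHomeomorph E E'}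
  {ext : E → E → E'} {x : E}

/-- Near a boundary point of `D` almost closest to `x` there is a centre whose ball has an image
at most half as large. -/
theorem exists_smaller_ball (hDne : f.source ≠ univ)
    (hext : ∀ x ∈ f.source, IsQSExtension η f x (bdryDist f.source x) (ext x))
    (hx : x ∈ f.source) {R : ℝ}
    (hR : ∀ s ∈ Metric.sphere x (bdryDist f.source x), dist (ext x s) (f x) ≤ R)
    (htarget : ∀ w, dist w (f x) ≤ R → w ∈ f.target) :
    ∃ p ∈ f.source, dist x p = bdryDist f.source x ∧
      bdryDist f.source p ≤ bdryDist f.source x / 2 ∧ dist (f x) (f p) ≤ R ∧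
      ∀ s ∈ Metric.sphere p (bdryDist f.source p), dist (ext p s) (f p) ≤ R / 2 := by
  have hH : 0 < max 1 (η 1) := zero_lt_one.trans_le (le_max_left 1 (η 1))
  -- Two applications of quasisymmetry cost the factor max(1, η(1)) η(δ), here at most 1/2.
  obtain ⟨δ, hδ0, hδ1, hδ⟩ := exists_pos_homeomorph_le η (e := (2 * max 1 (η 1))⁻¹) (by positivity)
  have hδ0R : (0 : ℝ) < δ := hδ0
  have hδ1R : (δ : ℝ) ≤ 1 / 2 := by exact_mod_cast hδ1
  set d := bdryDist f.source x with hd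
  have hdpos : 0 < d := bdryDist_pos f.open_source hDne hx
  have hB : Metric.ball x d ⊆ f.source := ball_bdryDist_subset f.open_source hx
  obtain ⟨z, hz, hxz⟩ := exists_mem_frontier_dist_lt hDne hx (r := d + δ * d) (by
    have := mul_pos hδ0R hdpos
    linarith)
  have hzD : z ∉ f.source := by rw [f.open_source.frontier_eq] at hz; exact hz.2
  have hzd : d ≤ dist x z := bdryDist_le_dist f.open_source hx hzD
  have hxz' : x ≠ z := fun he => hzD (he ▸ hx)
  obtain ⟨p, hpx, hpz⟩ := exists_dist_eq_on_line hxz' hdpos.le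
  rw [abs_of_nonneg (by linarith)] at hpz
  have hpc : p ∈ Metric.closedBall x d := hpx.le
  have hp : p ∈ f.source := (hext x hx).mem_source hdpos hB hpc (htarget _ (hR p hpx))
  have hfp : ext x p = f p := (hext x hx).eq_of_mem hdpos hpc hp
  have hfx : ext x x = f x := (hext x hx).eqOn (Metric.mem_ball_self hdpos)
  set e := bdryDist f.source p with he
  have hepos : 0 < e := bdryDist_pos f.open_source hDne hp
  have hed : e ≤ δ * d := (bdryDist_le_dist f.open_source hp hzD).trans (by linarith)
  have hed2 : e ≤ d / 2 := by nlinarith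
  have hfxp : dist (f p) (f x) ≤ R := hfp ▸ hR p hpx
  have hR0 : 0 ≤ R := dist_nonneg.trans hfxp
  refine ⟨p, hp, by rw [dist_comm, hpx], hed2, by rwa [dist_comm], fun s hs => ?_⟩
  have hpx' : p ≠ x := by
    rintro rfl
    rw [dist_self] at hpx
    exact hdpos.ne hpx
  -- The point of S_p towards x lies inside B_x. Quasisymmetry on the closed ball of x, centred at
  -- p, bounds |f(y) - f(p)|; quasisymmetry on that of p carries this to all of S_p.
  obtain ⟨y, hyp, hyx⟩ := exists_dist_eq_on_line hpx' hepos.le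
  rw [hpx, abs_of_nonneg (by linarith)] at hyx
  have hyB : y ∈ Metric.ball x d := by rw [Metric.mem_ball]; linarith
  have hyx' : y ≠ x := by
    rintro rfl
    rw [dist_self] at hyx
    linarith
  have h1 := (hext x hx).sphere p hpx y (Metric.ball_subset_closedBall hyB) hyx' δ
    (hyp.trans_le hed)
  rw [hfp, hfx, (hext x hx).eqOn hyB, dist_comm (f x)] at h1
  have h2 := (hext p hp).center y hyp s hs
  rw [(hext p hp).eqOn (Metric.mem_ball_self hepos),
    (hext p hp).eq_of_mem hepos hyp.le (hB hyB)] at h2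
  have h3 : (max 1 (η 1) : ℝ) * η δ ≤ 1 / 2 := by
    have : max 1 (η 1) * η δ ≤ 1 / 2 := by
      refine (mul_le_mul_right hδ _).trans_eq ?_
      field_simp
    exact_mod_cast this
  have hH' : (0 : ℝ) ≤ max 1 (η 1) := by positivity
  calc dist (ext p s) (f p) ≤ max 1 (η 1) * dist (f y) (f p) := h2
    _ ≤ max 1 (η 1) * (η δ * R) := mul_le_mul_of_nonneg_left
        (h1.trans (mul_le_mul_of_nonneg_left hfxp (η δ).2)) hH'
    _ = (max 1 (η 1) * η δ) * R := by ring
    _ ≤ 1 / 2 * R := mul_le_mul_of_nonneg_right h3 hR0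
    _ = R / 2 := by ring

variable [NormedSpace ℝ E']

/-- If D' contained a larger ball about f(x), `exists_smaller_ball` could be iterated forever.
Centres and images move by geometric steps, so both converge by completeness. The limit of the
images lies in D', so the centres converge to a point of D, yet their boundary distances tend to 0.
-/
theorem bdryDist_le_of_sphere_bound [CompleteSpace E] [CompleteSpace E'] (hDne : f.source ≠ univ)
    (hext : ∀ x ∈ f.source, IsQSExtension η f x (bdryDist f.source x) (ext x))
    (hx : x ∈ f.source) {R : ℝ} (hR0 : 0 ≤ R)
    (hR : ∀ s ∈ Metric.sphere x (bdryDist f.source x), dist (ext x s) (f x) ≤ R) :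
    bdryDist f.target (f x) ≤ 2 * R := by
  by_contra! hlt
  have hball := ball_bdryDist_subset f.open_target (f.map_source hx)
  -- The bound 2R - 2R/2ⁿ is the sum of the first n steps R, R/2, R/4, ….
  let P : ℕ → E → Prop := fun n p => p ∈ f.source ∧
    (∀ s ∈ Metric.sphere p (bdryDist f.source p), dist (ext p s) (f p) ≤ R * (1 / 2) ^ n) ∧
    dist (f p) (f x) ≤ 2 * R - 2 * R * (1 / 2) ^ n ∧
    bdryDist f.source p ≤ bdryDist f.source x * (1 / 2) ^ n
  have hnext : ∀ n, ∀ p : {p // P n p}, ∃ q : {q // P (n + 1) q},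
      dist (p : E) q ≤ bdryDist f.source x * (1 / 2) ^ n ∧
      dist (f p) (f q) ≤ R * (1 / 2) ^ n := by
    rintro n ⟨p, hp, hp1, hp2, hp3⟩
    have hRn : 0 ≤ R * (1 / 2) ^ n := by positivity
    obtain ⟨q, hq, hpq, hdq, hfq, hqs⟩ := exists_smaller_ball hDne hext hp hp1 fun w hw => by
      refine hball ?_
      rw [Metric.mem_ball]
      linarith [dist_triangle w (f p) (f x)]
    refine ⟨⟨q, hq, fun s hs => (hqs s hs).trans_eq (by ring), ?_, ?_⟩, hpq.trans_le hp3, hfq⟩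
    · have := dist_triangle_left (f q) (f x) (f p)
      rw [pow_succ]
      linarith
    · rw [pow_succ]
      linarith
  choose next hn1 hn2 using hnext
  let seq : ∀ n, {p // P n p} := fun n =>
    Nat.rec (motive := fun n => {p // P n p}) ⟨x, hx, by simpa using hR, by simp, by simp⟩ next n
  have hc1 : ∀ n, dist (seq n).1 (seq (n + 1)).1 ≤ bdryDist f.source x * (1 / 2) ^ n :=
    fun n => hn1 n (seq n)
  have hc2 : ∀ n, dist (f (seq n).1) (f (seq (n + 1)).1) ≤ R * (1 / 2) ^ n :=
    fun n => hn2 n (seq n)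
  obtain ⟨z, hz⟩ := cauchySeq_tendsto_of_complete
    (cauchySeq_of_le_geometric (1 / 2) _ (by norm_num) hc1)
  obtain ⟨w, hw⟩ := cauchySeq_tendsto_of_complete
    (cauchySeq_of_le_geometric (1 / 2) _ (by norm_num) hc2)
  have hwx : dist w (f x) ≤ 2 * R := by
    refine le_of_tendsto (hw.dist tendsto_const_nhds) (Filter.Eventually.of_forall fun n => ?_)
    have h1 := (seq n).2.2.2.1
    have h2 : 0 ≤ 2 * R * (1 / 2) ^ n := by positivity
    linarith
  have hwt : w ∈ f.target := hball (by rw [Metric.mem_ball]; linarith)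
  have hzs : z = f.symm w := by
    refine tendsto_nhds_unique hz ?_
    refine ((f.symm.continuousAt hwt).tendsto.comp hw).congr fun n => ?_
    exact f.left_inv (seq n).2.1
  have hzD : z ∈ f.source := hzs ▸ f.map_target hwt
  have hd0 : bdryDist f.source z ≤ 0 := by
    have h1 : Filter.Tendsto (fun n => bdryDist f.source (seq n).1) Filter.atTop
        (nhds (bdryDist f.source z)) :=
      ((Metric.continuous_infDist_pt _).tendsto z).comp hz
    have h2 : Filter.Tendsto (fun n : ℕ => bdryDist f.source x * (1 / 2) ^ n) Filter.atTop
        (nhds (bdryDist f.source x * 0)) :=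
      (tendsto_pow_atTop_nhds_zero_of_lt_one (by norm_num) (by norm_num)).const_mul _
    rw [mul_zero] at h2
    exact le_of_tendsto_of_tendsto' h1 h2 fun n => (seq n).2.2.2.2
  exact absurd (bdryDist_pos f.open_source hDne hzD) (not_lt.2 hd0)

/-- The image of the ball `B(x, d_D(x))` contains a ball about `f x` of radius comparable to
`d_{D'}(f x)`. -/
theorem bdryDist_target_le {φ : ℝ≥0 ≃ₜ ℝ≥0} [CompleteSpace E] [CompleteSpace E'] [Nontrivial E]
    (hDne : f.source ≠ univ) (hD'ne : f.target ≠ univ)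
    (hext : ∀ x ∈ f.source, IsQSExtension η f x (bdryDist f.source x) (ext x))
    (hx : x ∈ f.source)
    (hφ : ∀ y ∈ Metric.ball x (bdryDist f.source x),
      qhDist (f '' Metric.ball x (bdryDist f.source x)) (f x) (f y) ≤
        φ (qhDist (Metric.ball x (bdryDist f.source x)) x y).toNNReal) :
    ((4 * max 1 (η 1))⁻¹ : ℝ≥0) * bdryDist f.target (f x) ≤
      bdryDist (f '' Metric.ball x (bdryDist f.source x)) (f x) := by
  have hd := bdryDist_pos f.open_source hDne hx
  have hB := ball_bdryDist_subset f.open_source hx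
  have hsub : f '' Metric.ball x (bdryDist f.source x) ⊆ f.target := by
    rintro _ ⟨y, hy, rfl⟩
    exact f.map_source (hB hy)
  have himg : f '' Metric.ball x (bdryDist f.source x) ≠ univ := fun hu =>
    hD'ne (univ_subset_iff.1 (hu ▸ hsub))
  have hd' := bdryDist_pos f.open_target hD'ne (f.map_source hx)
  have hH : (0 : ℝ) < max 1 (η 1) := lt_max_of_lt_left one_pos
  by_contra! hlt
  obtain ⟨w, hw, hxw⟩ := exists_mem_frontier_dist_lt himg
    (mem_image_of_mem f (Metric.mem_ball_self hd)) hlt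
  obtain ⟨s, hs, hsw⟩ := (hext x hx).exists_sphere_dist_lt hd hB himg hφ hw (sub_pos.2 hxw)
  have hsx : dist (ext x s) (f x) < ((4 * max 1 (η 1))⁻¹ : ℝ≥0) * bdryDist f.target (f x) := by
    have := dist_triangle_right (ext x s) (f x) w
    linarith
  have hfx : ext x x = f x := (hext x hx).eqOn (Metric.mem_ball_self hd)
  -- The constant in the statement is chosen so that R is a quarter of d_{D'}(f x); the bound 2R is
  -- then half of it, a contradiction.
  have h1 := bdryDist_le_of_sphere_bound hDne hext hx (R := bdryDist f.target (f x) / 4)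
    (by linarith) fun q hq => by
      have h2 := (hext x hx).center s hs q hq
      rw [hfx] at h2
      refine h2.trans ((mul_le_mul_of_nonneg_left hsx.le hH.le).trans_eq ?_)
      push_cast
      field_simp
  linarith

end Distortion

end FreeQC

/-! ### The main theorem. -/

theorem theorem1p1 (φ η : ℝ≥0 ≃ₜ ℝ≥0) :
    ∃ ψ : ℝ≥0 ≃ₜ ℝ≥0, (∀ t, t ≤ ψ t) ∧
      ∀ (E : Type u) (E' : Type v)
        [NormedAddCommGroup E] [NormedSpace ℝ E] [CompleteSpace E]
        [NormedAddCommGroup E'] [NormedSpace ℝ E'] [CompleteSpace E'],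
        2 ≤ Module.rank ℝ E → 2 ≤ Module.rank ℝ E' →
        ∀ (D : Set E) (D' : Set E'), FreeQC.IsProperDomain D → FreeQC.IsProperDomain D' →
        ∀ f : OpenPartialHomeomorph E E', f.source = D → f.target = D' →
          (∀ x ∈ D,
            FreeQC.IsFQC φ (f.restrOpen (Metric.ball x (FreeQC.bdryDist D x)) Metric.isOpen_ball) ∧
            FreeQC.IsQSOnClosedBall η f x (FreeQC.bdryDist D x)) →
          FreeQC.IsFQC ψ f := by
  set c : ℝ≥0 := (4 * max 1 (η 1))⁻¹ with hc
  have hH1 : 1 ≤ max 1 (η 1) := le_max_left _ _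
  have hH : 0 < max 1 (η 1) := zero_lt_one.trans_le hH1
  have hc0 : 0 < c := by positivity
  have hc1 : c ≤ 1 := inv_le_one_of_one_le₀ (hH1.trans (le_mul_of_one_le_left hH.le (by norm_num)))
  obtain ⟨ψ, hψ⟩ := FreeQC.exists_homeomorph_dominating φ (3 / c)
    (2 * φ (3 / c * (c / 4)) / (c / 4))
  refine ⟨ψ, fun t => by rw [hψ]; exact le_add_self, ?_⟩
  rintro E E' _ _ _ _ _ _ hE - D D' ⟨hDo, hDc, hDne⟩ ⟨hD'o, hD'c, hD'ne⟩ f rfl rfl hf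
  have : Nontrivial E := by
    refine (rank_pos_iff_nontrivial (R := ℝ)).1 (lt_of_lt_of_le ?_ hE)
    exact two_pos
  have hex : ∀ x, ∃ g : E → E', x ∈ f.source →
      FreeQC.IsQSExtension η f x (FreeQC.bdryDist f.source x) g := by
    intro x
    by_cases hx : x ∈ f.source
    · obtain ⟨g, hg⟩ := (hf x hx).2.exists_extension (FreeQC.bdryDist_pos hDo hDne hx)
      exact ⟨g, fun _ => hg⟩
    · exact ⟨0, fun h => absurd h hx⟩
  choose ext hext using hex
  intro G hGo hGc hGD
  refine (FreeQC.isSolid_restrOpen_iff hGo hGD).2 fun x hx y hy => ?_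
  have hGne : G ≠ univ := fun h => hDne (univ_subset_iff.1 (h ▸ hGD))
  have himgo : IsOpen (f '' G) := f.isOpen_image_of_subset_source hGo hGD
  have himgD : f '' G ⊆ f.target := by
    rintro _ ⟨p, hp, rfl⟩
    exact f.map_source (hGD hp)
  have himgne : f '' G ≠ univ := fun h => hD'ne (univ_subset_iff.1 (h ▸ himgD))
  have himgc : IsConnected (f '' G) := hGc.image f (f.continuousOn.mono hGD)
  constructor
  · refine FreeQC.qhDist_le_of_local_control φ hc0 hc1 hψ hGo hGc.isPreconnected hGne ?_ hx hy
    intro p hp q hq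
    have hd := FreeQC.bdryDist_pos hGo hGne hp
    have hU : Metric.ball p (c * FreeQC.bdryDist G p) ⊆ Metric.ball p (FreeQC.bdryDist G p) :=
      Metric.ball_subset_ball (mul_le_of_le_one_left hd.le hc1)
    have hUG := hU.trans (FreeQC.ball_bdryDist_subset hGo hp)
    have hpU : p ∈ Metric.ball p (c * FreeQC.bdryDist G p) :=
      Metric.mem_ball_self (mul_pos (NNReal.coe_pos.2 hc0) hd)
    refine (FreeQC.qhDist_mono (f.isOpen_image_of_subset_source Metric.isOpen_ball
      (hUG.trans hGD)) himgo himgne (image_mono hUG) _ _).trans ?_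
    exact ((hf p (hGD hp)).1.qhDist_le Metric.isOpen_ball
      ((convex_ball _ _).isConnected ⟨p, hpU⟩) (hUG.trans hGD)
      (hU.trans (Metric.ball_subset_ball (FreeQC.bdryDist_mono hGo hDo hDne hGD hp))) hpU hq).1
  -- Local control is applied to f⁻¹ : f(G) → G, with the same c and ψ.
  · have hmain := FreeQC.qhDist_le_of_local_control (G' := G) (f := f.symm) φ hc0 hc1 hψ himgo
      himgc.isPreconnected himgne ?_ (mem_image_of_mem f hx) (mem_image_of_mem f hy)
    · rwa [f.left_inv (hGD hx), f.left_inv (hGD hy)] at hmain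
    rintro _ ⟨p, hp, rfl⟩ q hq
    have hpD := hGD hp
    have hdD := FreeQC.bdryDist_pos hDo hDne hpD
    have hd := FreeQC.bdryDist_pos himgo himgne (mem_image_of_mem f hp)
    have hBD := FreeQC.ball_bdryDist_subset hDo hpD
    have hbd := FreeQC.bdryDist_target_le (φ := φ) hDne hD'ne hext hpD fun q hq =>
      ((hf p hpD).1.qhDist_le Metric.isOpen_ball
        ((convex_ball _ _).isConnected ⟨p, Metric.mem_ball_self hdD⟩) hBD subset_rfl
        (Metric.mem_ball_self hdD) hq).1
    set W := Metric.ball (f p) (c * FreeQC.bdryDist (f '' G) (f p)) with hW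
    have hpW : f p ∈ W := Metric.mem_ball_self (mul_pos (NNReal.coe_pos.2 hc0) hd)
    have hWG : W ⊆ f '' G :=
      (Metric.ball_subset_ball (mul_le_of_le_one_left hd.le hc1)).trans
        (FreeQC.ball_bdryDist_subset himgo (mem_image_of_mem f hp))
    have hWB : W ⊆ f '' Metric.ball p (FreeQC.bdryDist f.source p) := by
      refine (Metric.ball_subset_ball (le_trans ?_ hbd)).trans (FreeQC.ball_bdryDist_subset
        (f.isOpen_image_of_subset_source Metric.isOpen_ball hBD)
        (mem_image_of_mem f (Metric.mem_ball_self hdD)))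
      exact mul_le_mul_of_nonneg_left
        (FreeQC.bdryDist_mono himgo hD'o hD'ne himgD (mem_image_of_mem f hp)) c.2
    have hWt : W ⊆ f.target := hWG.trans himgD
    have hVG : f.symm '' W ⊆ G := by
      rintro _ ⟨w, hw, rfl⟩
      obtain ⟨a, ha, rfl⟩ := hWG hw
      rwa [f.left_inv (hGD ha)]
    have hVB : f.symm '' W ⊆ Metric.ball p (FreeQC.bdryDist f.source p) := by
      rintro _ ⟨w, hw, rfl⟩
      obtain ⟨a, ha, rfl⟩ := hWB hw
      rwa [f.left_inv (hBD ha)]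
    have hVo : IsOpen (f.symm '' W) :=
      f.symm.isOpen_image_of_subset_source Metric.isOpen_ball hWt
    have hVc : IsConnected (f.symm '' W) :=
      ((convex_ball _ _).isConnected ⟨_, hpW⟩).image _ (f.symm.continuousOn.mono hWt)
    have hfV : f '' (f.symm '' W) = W := by
      rw [image_image]
      refine (image_congr fun w hw => f.right_inv (hWt hw)).trans (image_id' W)
    -- The set f⁻¹(W) need not be a ball, so control on all subdomains of B_p is needed here.
    have h1 := ((hf p hpD).1.qhDist_le hVo hVc (hVG.trans hGD) hVB
      (mem_image_of_mem f.symm hpW) (mem_image_of_mem f.symm hq)).2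
    rw [hfV, f.right_inv (hWt hpW), f.right_inv (hWt hq)] at h1
    exact (FreeQC.qhDist_mono hVo hGo hGne hVG _ _).trans h1
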